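/- **Model.** Consider $n\ge 2$ asynchronous processes that communicate through atomic multi-reader multi-writer registers (with values in a countable domain) and flip private coins; every coin flip yields an independent value from a countable space $\Omega$ with a fixed distribution $\mathcal D$. An execution is a sequence of steps (coin flips, reads, writes; a finished process that is scheduled performs a no-op). An adversary $A$ is a function mapping each finite execution $\mathcal E$ to the process that takes the next step; together with an algorithm $M$ and random coin flips it yields a random infinite execution $\mathcal E_{M,A}$. $A$ is *location-oblivious* for $M$ if $A(\mathcal E)$ depends only on (i) the past schedule (sequence of process IDs), (ii) for each process $p$, the values of the coin flips of $p$ preceding $p$'s latest shared memory step in $\mathcal E$, and (iii) for each unfinished process whose next step is a shared memory step, whether that step is a read or a write and, for a write, the value to be written. **Algorithm.** Let $\ell=\lceil\log_2 n\rceil$, and let $R[1],\dots,R[\ell+1]$ be registers, initially $0$, accessed only by the following method. $\mathrm{elect}()$: choose by a coin flip $x\in\{1,\dots,\ell\}$ with $\Pr(x=i)=2^{-i}$ for $1\le i<\ell$ and $\Pr(x=\ell)=2^{-(\ell-1)}$; write $1$ to $R[x]$; read $R[x+1]$; return *win* if the value read is $0$, and *lose* otherwise. (A coin flip whose value is ignored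 stands between the write and the read, so that coin flips and shared memory steps alternate.) **Measures.** Let $M$ be any algorithm for the $n$ processes in which each process calls $\mathrm{elect}()$ at most once, possibly besides arbitrary other steps. A process *participates* if it invokes $\mathrm{elect}()$, and is *elected* if its call returns win. The max-step complexity of $\mathrm{elect}()$ in an execution is the maximum over all processes $p$ of the number of shared memory steps that $p$ executes during its $\mathrm{elect}()$ call. The max-contention of a finite execution $\mathcal E'$ is the maximum number of processes that invoke $\mathrm{elect}()$ in any execution of $M$ that extends $\mathcal E'$. For $1\le k\le n$ let $\mathrm{Exec}_{M,A}(k)$ be the set of the finite executions $\mathcal E'$ of $M$ that result with positive probability for $A$, end when the first process becomes poised to invoke $\mathrm{elect}()$, and have max-contention at most $k$. The *effectiveness* in $M$ against $A$ is $$\varphi_{M,A}(k)=\sup_{\mathcal E'\in \mathrm{Exec}_{M,A}(k)}\mathbb E\bigl[\text{number of elected processes in }\mathcal E_{M,A}\,\bigm|\,\mathcal E_{M,A}\text{ extends }\mathcal E'\bigr],$$ and the *expected max-step complexity* $\tau_{M,A}(k)$ is defined in the same way from the max-step complexity of $\mathrm{elect}()$ in $\mathcal E_{M,A}$. **Lemma.**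 For every such $M$: 1. (Group election.) In every execution in which at least one process participates and all participating processes finish their $\mathrm{elect}()$ calls, at least one process is elected. Moreover, each call returns after at most three further steps of the calling process following its first step. 2. (Constant max-step complexity.) In every execution each process executes at most $2$ shared memory steps during its $\mathrm{elect}()$ call. In particular, against every location-oblivious adversary $A$ and for $1\le k\le n$, the max-step complexity is at most $2$ with conditional probability $1$ given that $\mathcal E_{M,A}$ extends $\mathcal E'$, for every $\mathcal E'\in\mathrm{Exec}_{M,A}(k)$, and $\tau_{M,A}(k)\le 2$. 3. (Effectiveness.) For every location-oblivious adversary $A$ for $M$ and every $1\le k\le n$, $\ \varphi_{M,A}(k)\le 2\log_2 k+4$. -/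

import Mathlib

open MeasureTheory ProbabilityTheory
open scoped ENNReal

namespace GroupElection

/-! ### Asynchronous shared memory: `n` processes, atomic registers, private coin flips

Every coin flip yields a value in the countable space `Ω` with the fixed distribution `D`.
Registers hold natural numbers, i.e. values of a countable domain. -/

/-- `ℓ = ⌈log₂ n⌉`. -/
def ell (n : ℕ) : ℕ := Nat.clog 2 n

/-- A way of choosing, by one coin flip, a random index `x ∈ {1, …, ℓ}` with
`Pr(x = i) = 2^{-i}` for `1 ≤ i < ℓ` and `Pr(x = ℓ) = 2^{-(ℓ-1)}`. -/
structure IndexChoice (n : ℕ) {Ω : Type*} (D : PMF Ω) where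
  x : Ω → ℕ
  one_le : ∀ c, 1 ≤ x c
  le_ell : ∀ c, x c ≤ ell n
  prob_of_lt : ∀ i, 1 ≤ i → i < ell n → D.map x i = (2⁻¹ : ℝ≥0∞) ^ i
  prob_ell : D.map x (ell n) = (2⁻¹ : ℝ≥0∞) ^ (ell n - 1)

/-- What a process that executes its own code does next: it has finished, or it flips a coin,
reads or writes one of the registers of the algorithm, or calls `elect()` on the group election
object, whose answer (`true` for win, `false` for lose) is all it learns from the call. -/
inductive Action (Ω Reg State : Type*) where
  | halt
  | flip (next : Ω → State)
  | read (r : Reg) (next : ℕ → State)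
  | write (r : Reg) (v : ℕ) (next : State)
  | elect (next : Bool → State)

/-- An algorithm for `n` processes that uses a group election object and registers `Reg`. -/
structure Algorithm (n : ℕ) (Ω Reg State : Type*) where
  initState : Fin n → State
  initMem : Reg → ℕ
  act : Fin n → State → Action Ω Reg State

/-- Local state of a process: running its own code, or inside the call of `elect()`, where it
has chosen the index `x` and continues with `next` once the call has returned. -/
inductive LocalState (State : Type*) where
  | main (s : State)
  | toWrite (x : ℕ) (next : Bool → State)
  | toFlip (x : ℕ) (next : Bool → State)
  | toRead (x : ℕ) (next : Bool → State)

/-- A shared register: one of the algorithm's, or `R[i]` of the group election object. -/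
inductive Loc (Reg : Type*) where
  | base (r : Reg)
  | R (i : ℕ)

/-- Kind of a step, with the affected register and the value returned or written. A finished
process that is scheduled executes a `noop`. -/
inductive Op (Ω Reg : Type*) where
  | flip (c : Ω)
  | read (l : Loc Reg) (v : ℕ)
  | write (l : Loc Reg) (v : ℕ)
  | noop

/-- Position of a step relative to the `elect()` call of its process: outside of the call, the
first step of the call, an inner step, or the last step, in which the call returns `b`. -/
inductive Tag where
  | outside
  | invoke
  | inner
  | ret (b : Bool)

/-- One step of an execution. -/
structure Step (n : ℕ) (Ω Reg : Type*) where
  pid : Fin n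
  op : Op Ω Reg
  tag : Tag

/-- A finite execution, in chronological order. -/
abbrev Execution (n : ℕ) (Ω Reg : Type*) := List (Step n Ω Reg)

/-- A configuration, together with the execution that led to it and the number of coin flips
in that execution. -/
structure Config (n : ℕ) (Ω Reg State : Type*) where
  loc : Fin n → LocalState State
  mem : Reg → ℕ
  R : ℕ → ℕ
  flips : ℕ
  trace : Execution n Ω Reg

section Semantics

variable {n : ℕ} {Ω Reg State : Type*} [DecidableEq Reg] {D : PMF Ω}

def Algorithm.init (M : Algorithm n Ω Reg State) : Config n Ω Reg State where
  loc p := .main (M.initState p)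
  mem := M.initMem
  R _ := 0
  flips := 0
  trace := []

/-- The next step, by process `p`, from configuration `C`, where `ω` is the coin flip vector.
The method `elect()` is:
choose `x` at random; `R[x].write(1)`; if `R[x+1].read() = 0` return win, else return lose.
Processes alternate between coin flips and shared memory steps, so that a coin flip whose value
is ignored stands between the write and the read. The algorithm's own code need not alternate. -/
def Algorithm.step (M : Algorithm n Ω Reg State) (ch : IndexChoice n D) (ω : ℕ → Ω)
    (C : Config n Ω Reg State) (p : Fin n) : Config n Ω Reg State :=
  let c := ω C.flips
  match C.loc p with
  | .main s =>
    match M.act p s with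
    | .halt => { C with trace := C.trace ++ [⟨p, .noop, .outside⟩] }
    | .flip next =>
      { C with
        loc := Function.update C.loc p (.main (next c))
        flips := C.flips + 1
        trace := C.trace ++ [⟨p, .flip c, .outside⟩] }
    | .read r next =>
      { C with
        loc := Function.update C.loc p (.main (next (C.mem r)))
        trace := C.trace ++ [⟨p, .read (.base r) (C.mem r), .outside⟩] }
    | .write r v next =>
      { C with
        loc := Function.update C.loc p (.main next)
        mem := Function.update C.mem r v
        trace := C.trace ++ [⟨p, .write (.base r) v, .outside⟩] }
    | .elect next =>
      { C with
        loc := Function.update C.loc p (.toWrite (ch.x c) next)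
        flips := C.flips + 1
        trace := C.trace ++ [⟨p, .flip c, .invoke⟩] }
  | .toWrite x next =>
    { C with
      loc := Function.update C.loc p (.toFlip x next)
      R := Function.update C.R x 1
      trace := C.trace ++ [⟨p, .write (.R x) 1, .inner⟩] }
  | .toFlip x next =>
    { C with
      loc := Function.update C.loc p (.toRead x next)
      flips := C.flips + 1
      trace := C.trace ++ [⟨p, .flip c, .inner⟩] }
  | .toRead x next =>
    let v := C.R (x + 1)
    let b : Bool := decide (v = 0)
    { C with
      loc := Function.update C.loc p (.main (next b))
      trace := C.trace ++ [⟨p, .read (.R (x + 1)) v, .ret b⟩] }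

/-- The configuration after the first `t` entries of the schedule `σ`, with coin flip
vector `ω`. -/
def Algorithm.run (M : Algorithm n Ω Reg State) (ch : IndexChoice n D) (σ : ℕ → Fin n)
    (ω : ℕ → Ω) : ℕ → Config n Ω Reg State
  | 0 => M.init
  | t + 1 => M.step ch ω (M.run ch σ ω t) (σ t)

/-- `C` results from a finite execution of `M`. -/
def Algorithm.Reachable (M : Algorithm n Ω Reg State) (ch : IndexChoice n D)
    (C : Config n Ω Reg State) : Prop :=
  ∃ (σ : ℕ → Fin n) (ω : ℕ → Ω) (t : ℕ), C = M.run ch σ ω t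

end Semantics

/-! ### Quantities of an execution -/

section Executions

variable {n : ℕ} {Ω Reg State : Type*}

def Op.isShared : Op Ω Reg → Bool
  | .read _ _ => true
  | .write _ _ => true
  | _ => false

def Op.coin : Op Ω Reg → Option Ω
  | .flip c => some c
  | _ => none

def Tag.isInvoke : Tag → Bool
  | .invoke => true
  | _ => false

def Tag.inCall : Tag → Bool
  | .outside => false
  | _ => true

/-- `p` participates: it invokes `elect()`. -/
def Participates (E : Execution n Ω Reg) (p : Fin n) : Prop :=
  ∃ s ∈ E, s.pid = p ∧ s.tag = .invoke

/-- The `elect()` call of `p` returns `b`. -/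
def Returns (E : Execution n Ω Reg) (p : Fin n) (b : Bool) : Prop :=
  ∃ s ∈ E, s.pid = p ∧ s.tag = .ret b

/-- Number of shared memory steps that `p` executes during its `elect()` call. -/
def electSteps (E : Execution n Ω Reg) (p : Fin n) : ℕ :=
  E.countP fun s => decide (s.pid = p) && s.op.isShared && s.tag.inCall

/-- Number of times that `p` invokes `elect()`. -/
def invocations (E : Execution n Ω Reg) (p : Fin n) : ℕ :=
  E.countP fun s => decide (s.pid = p) && s.tag.isInvoke

/-- Each process calls `elect()` at most once, in every execution of `M`. -/
def Algorithm.OneTime [DecidableEq Reg] {D : PMF Ω} (M : Algorithm n Ω Reg State)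
    (ch : IndexChoice n D) : Prop :=
  ∀ C, M.Reachable ch C → ∀ p, invocations C.trace p ≤ 1

/-- If at least one process participates and all participating processes finish their
`elect()` calls, then at least one process gets elected. -/
def GroupElectionProperty (E : Execution n Ω Reg) : Prop :=
  (∃ p, Participates E p) → (∀ p, Participates E p → ∃ b, Returns E p b) →
    ∃ p, Returns E p true

/-- Process `p` is poised to invoke `elect()`. -/
def Algorithm.Poised (M : Algorithm n Ω Reg State) (C : Config n Ω Reg State) (p : Fin n) : Prop :=
  ∃ s next, C.loc p = .main s ∧ M.act p s = .elect next

end Executions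

/-! ### Adversaries -/

section Adversaries

variable {n : ℕ} {Ω Reg State : Type*} [DecidableEq Reg] {D : PMF Ω}

/-- An adversary maps a finite execution to the process that takes the next step. -/
abbrev Adversary (n : ℕ) (Ω Reg : Type*) := Execution n Ω Reg → Fin n

/-- A pending shared memory step, without its register. -/
inductive Pending where
  | read
  | write (v : ℕ)

/-- The pending shared memory step of `p`; `none` if `p` has finished or its next step is a
coin flip. -/
def Algorithm.pending (M : Algorithm n Ω Reg State) (C : Config n Ω Reg State) (p : Fin n) :
    Option Pending :=
  match C.loc p with
  | .main s =>
    match M.act p s with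
    | .read _ _ => some .read
    | .write _ v _ => some (.write v)
    | _ => none
  | .toWrite _ _ => some (.write 1)
  | .toFlip _ _ => none
  | .toRead _ _ => some .read

/-- The values of the coin flips of `p` that precede its latest shared memory step. -/
def revealedCoins (E : Execution n Ω Reg) (p : Fin n) : List Ω :=
  ((E.filter fun s => decide (s.pid = p)).rdropWhile fun s => !s.op.isShared).filterMap
    fun s => s.op.coin

/-- `A` is location-oblivious for `M`: its decision depends only on the past schedule, on the
coin flips of each process that precede its latest shared memory step, and, for each process
whose next step is a shared memory step, on whether that step is a read or a write and, for a
write, on the value to be written. -/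
def LocationOblivious (M : Algorithm n Ω Reg State) (ch : IndexChoice n D)
    (A : Adversary n Ω Reg) : Prop :=
  ∀ C C', M.Reachable ch C → M.Reachable ch C' →
    C.trace.map Step.pid = C'.trace.map Step.pid →
    (∀ p, revealedCoins C.trace p = revealedCoins C'.trace p) →
    (∀ p, M.pending C p = M.pending C' p) →
    A C.trace = A C'.trace

/-- The configuration after `t` steps scheduled by `A`, with coin flip vector `ω`. -/
def Algorithm.exec (M : Algorithm n Ω Reg State) (ch : IndexChoice n D) (A : Adversary n Ω Reg)
    (ω : ℕ → Ω) : ℕ → Config n Ω Reg State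
  | 0 => M.init
  | t + 1 => M.step ch ω (M.exec ch A ω t) (A (M.exec ch A ω t).trace)

end Adversaries

/-! ### Max-contention, effectiveness, max-step complexity -/

noncomputable section Measures

variable {n : ℕ} {Ω Reg State : Type*} [DecidableEq Reg] {D : PMF Ω}

/-- The product distribution `D^∞` of the coin flip vector. -/
def coinMeasure [MeasurableSpace Ω] (D : PMF Ω) : Measure (ℕ → Ω) :=
  Measure.infinitePi fun _ => D.toMeasure

/-- Max-contention: the maximum number of processes that invoke `elect()` in an execution of
`M` that extends `E`. -/
def maxContention (M : Algorithm n Ω Reg State) (ch : IndexChoice n D)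
    (E : Execution n Ω Reg) : ℕ :=
  sSup {m | ∃ C, M.Reachable ch C ∧ E <+: C.trace ∧ m = {p | Participates C.trace p}.ncard}

/-- The event that the random execution of `M` scheduled by `A` is an extension of `E`. -/
def extends_ (M : Algorithm n Ω Reg State) (ch : IndexChoice n D) (A : Adversary n Ω Reg)
    (E : Execution n Ω Reg) : Set (ℕ → Ω) :=
  {ω | ∃ t, (M.exec ch A ω t).trace = E}

/-- The executions that can result (with positive probability) for adversary `A`, end when the
first process becomes poised to invoke `elect()`, and have max-contention at most `k`. -/
def startExecs [MeasurableSpace Ω] (M : Algorithm n Ω Reg State) (ch : IndexChoice n D)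
    (A : Adversary n Ω Reg) (k : ℕ) : Set (Execution n Ω Reg) :=
  {E | coinMeasure D (extends_ M ch A E) ≠ 0 ∧
    (∃ ω t, (M.exec ch A ω t).trace = E ∧ (∃ p, M.Poised (M.exec ch A ω t) p) ∧
      ∀ s < t, ∀ p, ¬ M.Poised (M.exec ch A ω s) p) ∧
    maxContention M ch E ≤ k}

/-- Number of processes that get elected in the execution of `M` scheduled by `A`. -/
def wins (M : Algorithm n Ω Reg State) (ch : IndexChoice n D) (A : Adversary n Ω Reg)
    (ω : ℕ → Ω) : ℕ :=
  {p | ∃ t, Returns (M.exec ch A ω t).trace p true}.ncard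

/-- Max-step complexity of `elect()` in the execution of `M` scheduled by `A`. -/
def maxSteps (M : Algorithm n Ω Reg State) (ch : IndexChoice n D) (A : Adversary n Ω Reg)
    (ω : ℕ → Ω) : ℝ≥0∞ :=
  ⨆ (p : Fin n) (t : ℕ), (electSteps (M.exec ch A ω t).trace p : ℝ≥0∞)

/-- Effectiveness of the group election object in `M` against `A`. -/
def effectiveness [MeasurableSpace Ω] (M : Algorithm n Ω Reg State) (ch : IndexChoice n D)
    (A : Adversary n Ω Reg) (k : ℕ) : ℝ≥0∞ :=
  ⨆ E ∈ startExecs M ch A k,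
    ∫⁻ ω, (wins M ch A ω : ℝ≥0∞) ∂(cond (coinMeasure D) (extends_ M ch A E))

/-- Adaptive expected max-step complexity of `elect()` in `M` against `A`. -/
def expectedMaxSteps [MeasurableSpace Ω] (M : Algorithm n Ω Reg State) (ch : IndexChoice n D)
    (A : Adversary n Ω Reg) (k : ℕ) : ℝ≥0∞ :=
  ⨆ E ∈ startExecs M ch A k,
    ∫⁻ ω, maxSteps M ch A ω ∂(cond (coinMeasure D) (extends_ M ch A E))

/-- The adaptive max-step complexity of `elect()` in `M` against `A` is bounded by `b k` with
probability `q k`. -/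
def MaxStepsBoundedWithProb [MeasurableSpace Ω] (M : Algorithm n Ω Reg State)
    (ch : IndexChoice n D) (A : Adversary n Ω Reg) (b q : ℕ → ℝ≥0∞) (k : ℕ) : Prop :=
  ∀ E ∈ startExecs M ch A k,
    q k ≤ cond (coinMeasure D) (extends_ M ch A E) {ω | maxSteps M ch A ω ≤ b k}

end Measures

end GroupElection

open GroupElection

/-!
A participant that chose the largest index `x` reads the register `R[x + 1]`, which nobody writes,
and therefore wins.

For the effectiveness, a location-oblivious adversary sees the index chosen by a process only once
the process has written. Hence neither the time of the write nor the memory at that time depends on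
this index. Let `Sᵢ` be the expected number of processes that write, to any index, while `R[i + 1]`
is still `0`. By independence the expected number of winners is at most `∑ᵢ Sᵢ Pr(x = i)`, while
`Sᵢ Pr(x = i + 1)` is the expected number of processes that write to `R[i + 1]` while it is `0`,
which is at most `1`. Together with `Sᵢ ≤ k` this bounds the terms with `i < ℓ` by
`min 2 (k 2⁻ⁱ)`, and the last term is at most `2` because `k ≤ 2 ^ ℓ`.
-/

namespace GroupElection

section Executions

variable {n : ℕ} {Ω Reg : Type*} {E F : Execution n Ω Reg} {p : Fin n}

lemma participates_iff_invocations_pos : Participates E p ↔ 0 < invocations E p := by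
  simp only [Participates, invocations, List.countP_pos_iff, Bool.and_eq_true, decide_eq_true_eq]
  refine exists_congr fun s => and_congr_right fun _ => and_congr_right fun _ => ?_
  cases s.tag <;> simp [Tag.isInvoke]

lemma Participates.mono (h : Participates E p) (hEF : E <+: F) : Participates F p :=
  let ⟨s, hs, hsp⟩ := h
  ⟨s, hEF.subset hs, hsp⟩

lemma Returns.mono {b : Bool} (h : Returns E p b) (hEF : E <+: F) : Returns F p b :=
  let ⟨s, hs, hsp⟩ := h
  ⟨s, hEF.subset hs, hsp⟩

lemma returns_concat {st : Step n Ω Reg} {b : Bool} :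
    Returns (E ++ [st]) p b ↔ Returns E p b ∨ st.pid = p ∧ st.tag = .ret b := by
  simp [Returns, or_and_right, exists_or]

lemma invocations_concat (st : Step n Ω Reg) :
    invocations (E ++ [st]) p
      = invocations E p + if st.pid = p ∧ st.tag.isInvoke then 1 else 0 := by
  simp [invocations, List.countP_append, List.countP_cons]

lemma electSteps_concat (st : Step n Ω Reg) :
    electSteps (E ++ [st]) p
      = electSteps E p + if (st.pid = p ∧ st.op.isShared) ∧ st.tag.inCall then 1 else 0 := by
  simp [electSteps, List.countP_append, List.countP_cons]

end Executions

section Steps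

variable {n : ℕ} {Ω Reg State : Type*} [DecidableEq Reg] {D : PMF Ω}
variable (M : Algorithm n Ω Reg State) (ch : IndexChoice n D)

lemma Algorithm.exists_step_eq {ω ω' : ℕ → Ω} {C C' : Config n Ω Reg State} {p : Fin n}
    (hloc : C.loc p = C'.loc p) (hmem : C.mem = C'.mem) (hR : C.R = C'.R)
    (hcoin : ω C.flips = ω' C'.flips) :
    ∃ (st : Step n Ω Reg) (l : LocalState State) (mem : Reg → ℕ) (R : ℕ → ℕ) (d : ℕ),
      st.pid = p ∧ d ≤ 1 ∧
      M.step ch ω C p = ⟨Function.update C.loc p l, mem, R, C.flips + d, C.trace ++ [st]⟩ ∧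
      M.step ch ω' C' p = ⟨Function.update C'.loc p l, mem, R, C'.flips + d, C'.trace ++ [st]⟩ := by
  rcases hl : C.loc p with s | _ | _ | _
  · rcases ha : M.act p s with _ | _ | _ | _ | _ <;>
      simp only [Algorithm.step, hl, hloc ▸ hl, ha, ← hmem, ← hR, ← hcoin]
    · exact ⟨_, .main s, _, _, 0, rfl, zero_le_one, by rw [← hl, Function.update_eq_self]; rfl,
        by rw [← hl, hloc, Function.update_eq_self]; rfl⟩
    · exact ⟨_, _, _, _, 1, rfl, le_rfl, rfl, rfl⟩
    · exact ⟨_, _, _, _, 0, rfl, zero_le_one, rfl, rfl⟩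
    · exact ⟨_, _, _, _, 0, rfl, zero_le_one, rfl, rfl⟩
    · exact ⟨_, _, _, _, 1, rfl, le_rfl, rfl, rfl⟩
  all_goals simp only [Algorithm.step, hl, hloc ▸ hl, ← hmem, ← hR, ← hcoin]
  · exact ⟨_, _, _, _, 0, rfl, zero_le_one, rfl, rfl⟩
  · exact ⟨_, _, _, _, 1, rfl, le_rfl, rfl, rfl⟩
  · exact ⟨_, _, _, _, 0, rfl, zero_le_one, rfl, rfl⟩

variable (ω : ℕ → Ω) (C : Config n Ω Reg State) (p : Fin n)

lemma Algorithm.exists_step_trace_eq :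
    ∃ st : Step n Ω Reg, st.pid = p ∧ (M.step ch ω C p).trace = C.trace ++ [st] := by
  obtain ⟨st, l, mem, R, d, hp, -, h, -⟩ := M.exists_step_eq ch (C := C) (p := p) rfl rfl rfl rfl
  exact ⟨st, hp, by rw [h]⟩

lemma Algorithm.step_loc_of_ne {p q : Fin n} (hqp : q ≠ p) :
    (M.step ch ω C p).loc q = C.loc q := by
  obtain ⟨st, l, mem, R, d, -, -, h, -⟩ := M.exists_step_eq ch (C := C) (p := p) rfl rfl rfl rfl
  rw [h]
  exact Function.update_of_ne hqp ..

lemma Algorithm.flips_le_step_flips : C.flips ≤ (M.step ch ω C p).flips := by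
  obtain ⟨st, l, mem, R, d, -, -, h, -⟩ := M.exists_step_eq ch (C := C) (p := p) rfl rfl rfl rfl
  rw [h]
  exact Nat.le_add_right _ _

lemma Algorithm.step_flips_le : (M.step ch ω C p).flips ≤ C.flips + 1 := by
  obtain ⟨st, l, mem, R, d, -, hd, h, -⟩ := M.exists_step_eq ch (C := C) (p := p) rfl rfl rfl rfl
  rw [h]
  exact Nat.add_le_add_left hd _

variable {M ch ω C p}

lemma Algorithm.step_congr {ω' : ℕ → Ω} (h : ∀ i < (M.step ch ω C p).flips, ω i = ω' i) :
    M.step ch ω' C p = M.step ch ω C p := by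
  unfold Algorithm.step at h ⊢
  split
  · split <;> simp_all
  all_goals simp_all

lemma Algorithm.step_R_ne_zero_iff {j : ℕ} :
    (M.step ch ω C p).R j ≠ 0 ↔ C.R j ≠ 0 ∨ ∃ next, C.loc p = .toWrite j next := by
  unfold Algorithm.step
  split
  · split <;> simp_all
  · grind
  all_goals simp_all

lemma Algorithm.step_loc_eq_toWrite_iff {x : ℕ} :
    (∃ next, (M.step ch ω C p).loc p = .toWrite x next) ↔
      M.Poised C p ∧ ch.x (ω C.flips) = x := by
  unfold Algorithm.step Algorithm.Poised
  split
  · split <;> simp_all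
  all_goals simp_all

lemma Algorithm.loc_eq_toWrite_of_step {x : ℕ} {next : Bool → State}
    (h : (M.step ch ω C p).loc p = .toFlip x next) : C.loc p = .toWrite x next := by
  unfold Algorithm.step at h
  split at h
  · split at h <;> simp_all
  all_goals simp_all

lemma Algorithm.loc_eq_toFlip_of_step {x : ℕ} {next : Bool → State}
    (h : (M.step ch ω C p).loc p = .toRead x next) : C.loc p = .toFlip x next := by
  unfold Algorithm.step at h
  split at h
  · split at h <;> simp_all
  all_goals simp_all

lemma Algorithm.returns_step {q : Fin n} {b : Bool} (h : Returns (M.step ch ω C p).trace q b) :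
    Returns C.trace q b ∨
      p = q ∧ ∃ x next, C.loc p = .toRead x next ∧ b = decide (C.R (x + 1) = 0) := by
  unfold Algorithm.step at h
  split at h
  · split at h <;> simp_all [returns_concat]
  all_goals simp_all [returns_concat]; try grind

open Classical in
lemma Algorithm.invocations_step (q : Fin n) :
    invocations (M.step ch ω C p).trace q
      = invocations C.trace q + if p = q ∧ M.Poised C p then 1 else 0 := by
  unfold Algorithm.step Algorithm.Poised
  split
  · split <;> simp_all [invocations_concat, Tag.isInvoke]
  all_goals simp_all [invocations_concat, Tag.isInvoke]

lemma Algorithm.Poised.step_eq (h : M.Poised C p) :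
    ∃ next, M.step ch ω C p =
      { C with
        loc := Function.update C.loc p (.toWrite (ch.x (ω C.flips)) next)
        flips := C.flips + 1
        trace := C.trace ++ [⟨p, .flip (ω C.flips), .invoke⟩] } := by
  obtain ⟨s, next, hs, hact⟩ := h
  exact ⟨next, by simp only [Algorithm.step, hs, hact]⟩

/-- Number of steps that a process in the given local state has yet to take in its pending
`elect()` call, including the one in which the call returns. -/
def LocalState.stepsLeft : LocalState State → ℕ
  | .main _ => 0
  | .toWrite _ _ => 3
  | .toFlip _ _ => 2
  | .toRead _ _ => 1

lemma Algorithm.stepsLeft_step (h : 0 < (C.loc p).stepsLeft) :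
    ((M.step ch ω C p).loc p).stepsLeft + 1 = (C.loc p).stepsLeft ∧
      ((C.loc p).stepsLeft = 1 → ∃ b, Returns (M.step ch ω C p).trace p b) := by
  unfold Algorithm.step
  split <;> simp_all [LocalState.stepsLeft, returns_concat]

-- Flips and shared memory steps alternate during a call, and the call ends with the latter.
lemma Algorithm.Reachable.electSteps_add (hC : M.Reachable ch C) (q : Fin n) :
    electSteps C.trace q + ((C.loc q).stepsLeft + 1) / 2 = 2 * invocations C.trace q := by
  obtain ⟨σ, ω, t, rfl⟩ := hC
  induction t with
  | zero =>
    simp [Algorithm.run, Algorithm.init, electSteps, invocations, LocalState.stepsLeft]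
  | succ t ih =>
    rw [Algorithm.run]
    generalize M.run ch σ ω t = C, σ t = p at ih ⊢
    by_cases hpq : q = p
    · subst hpq
      unfold Algorithm.step
      split
      · split <;>
          simp_all [invocations_concat, electSteps_concat, LocalState.stepsLeft, Tag.isInvoke,
            Op.isShared, Tag.inCall, mul_add]
      all_goals
        simp_all [invocations_concat, electSteps_concat, LocalState.stepsLeft, Tag.isInvoke,
          Op.isShared, Tag.inCall]
    · obtain ⟨st, hst, htr⟩ := M.exists_step_trace_eq ch ω C p
      have hne : st.pid ≠ q := fun h => hpq (h.symm.trans hst)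
      simpa [M.step_loc_of_ne ch ω C hpq, htr, invocations_concat, electSteps_concat, hne] using ih

lemma Algorithm.Reachable.electSteps_le_two (hC : M.Reachable ch C) (hM : M.OneTime ch)
    (q : Fin n) : electSteps C.trace q ≤ 2 := by
  have := hC.electSteps_add q
  have := hM C hC q
  lia

end Steps

section Runs

variable {n : ℕ} {Ω Reg State : Type*} [DecidableEq Reg] {D : PMF Ω}
variable {M : Algorithm n Ω Reg State} {ch : IndexChoice n D} {σ : ℕ → Fin n} {ω : ℕ → Ω}
variable {p : Fin n} {m m' s s' t t' : ℕ}

lemma Algorithm.reachable_run : M.Reachable ch (M.run ch σ ω t) := ⟨σ, ω, t, rfl⟩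

lemma Algorithm.run_trace_prefix (hst : s ≤ t) :
    (M.run ch σ ω s).trace <+: (M.run ch σ ω t).trace := by
  induction t, hst using Nat.le_induction with
  | base => exact List.prefix_rfl
  | succ t _ ih =>
    obtain ⟨st, -, h⟩ := M.exists_step_trace_eq ch ω (M.run ch σ ω t) (σ t)
    exact ih.trans (h ▸ List.prefix_append ..)

open Classical in
lemma Algorithm.run_invocations :
    invocations (M.run ch σ ω t).trace p
      = {s ∈ Finset.range t | σ s = p ∧ M.Poised (M.run ch σ ω s) p}.card := by
  induction t with
  | zero => rfl
  | succ t ih =>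
    rw [Algorithm.run, Algorithm.invocations_step, ih, Finset.range_add_one, Finset.filter_insert]
    by_cases h : σ t = p
    · subst h
      by_cases hP : M.Poised (M.run ch σ ω t) (σ t) <;> simp [hP]
    · simp [h]

lemma Algorithm.participates_run_iff :
    Participates (M.run ch σ ω t).trace p ↔ ∃ s < t, σ s = p ∧ M.Poised (M.run ch σ ω s) p := by
  simp [participates_iff_invocations_pos, Algorithm.run_invocations, Finset.card_pos,
    Finset.filter_nonempty_iff]

lemma Algorithm.OneTime.invocation_unique (hM : M.OneTime ch)
    (hs : σ s = p) (hPs : M.Poised (M.run ch σ ω s) p)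
    (hs' : σ s' = p) (hPs' : M.Poised (M.run ch σ ω s') p) : s = s' := by
  classical
  have h := hM _ (M.reachable_run (ch := ch) (σ := σ) (ω := ω) (t := max s s' + 1)) p
  rw [Algorithm.run_invocations, Finset.card_le_one] at h
  exact h s (by simp [hs, hPs]) s' (by simp [hs', hPs'])

lemma Algorithm.returns_or_stepsLeft (hs : σ s = p) (hPs : M.Poised (M.run ch σ ω s) p)
    (hst : s < t) :
    (∃ b, Returns (M.run ch σ ω t).trace p b) ∨
      0 < ((M.run ch σ ω t).loc p).stepsLeft ∧
      ((M.run ch σ ω t).loc p).stepsLeft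
        + ((Finset.Ico (s + 1) t).filter fun r => σ r = p).card = 3 := by
  induction t, hst using Nat.le_induction with
  | base =>
    obtain ⟨next, h⟩ := hPs.step_eq (ch := ch) (ω := ω)
    simp [Algorithm.run, hs, h, LocalState.stepsLeft]
  | succ t hst ih =>
    rcases ih with ⟨b, hb⟩ | ⟨hpos, hcard⟩
    · exact .inl ⟨b, hb.mono (M.run_trace_prefix t.le_succ)⟩
    rw [← Finset.insert_Ico_right_eq_Ico_add_one hst, Finset.filter_insert, Algorithm.run]
    by_cases hσ : σ t = p
    · obtain ⟨hleft, hret⟩ := M.stepsLeft_step (ch := ch) (ω := ω) hpos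
      rw [if_pos hσ, Finset.card_insert_of_notMem (by simp), hσ]
      by_cases h1 : ((M.run ch σ ω t).loc p).stepsLeft = 1
      · exact .inl (hret h1)
      · exact .inr (by lia)
    · rw [if_neg hσ, M.step_loc_of_ne ch ω _ (Ne.symm hσ)]
      exact .inr ⟨hpos, hcard⟩

lemma Algorithm.exists_returns_of_three_steps (hp : Participates (M.run ch σ ω t).trace p)
    (h3 : 3 ≤ ((Finset.Ico t t').filter fun r => σ r = p).card) :
    ∃ b, Returns (M.run ch σ ω t').trace p b := by
  obtain ⟨s, hst, hs, hPs⟩ := Algorithm.participates_run_iff.1 hp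
  have htt' : t < t' := by
    by_contra h
    simp [Finset.Ico_eq_empty h] at h3
  have hcard : ((Finset.Ico t t').filter fun r => σ r = p).card
      ≤ ((Finset.Ico (s + 1) t').filter fun r => σ r = p).card := by gcongr; lia
  rcases Algorithm.returns_or_stepsLeft hs hPs (hst.trans htt') with h | h
  · exact h
  · lia

variable (M ch σ ω p m) in
/-- At time `t`, process `p` is poised to write in its `elect()` call, the index of which was
chosen by the coin flip number `m`. The chosen index itself is not mentioned, so that the
condition can be compared between runs in which it differs. -/
def PendingWrite : ℕ → Prop
  | 0 => False
  | t + 1 =>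
    σ t = p ∧ M.Poised (M.run ch σ ω t) p ∧ (M.run ch σ ω t).flips = m ∨
      σ t ≠ p ∧ PendingWrite t

variable (M ch σ ω p m) in
/-- Step number `w` is the write of `p` in its `elect()` call, the index of which was chosen by
the coin flip number `m`. -/
structure WritesAt (w : ℕ) : Prop where
  pending : PendingWrite M ch σ ω p m w
  scheduled : σ w = p

lemma PendingWrite.exists_invocation (h : PendingWrite M ch σ ω p m t) :
    ∃ s < t, σ s = p ∧ M.Poised (M.run ch σ ω s) p ∧ (M.run ch σ ω s).flips = m := by
  induction t with
  | zero => exact h.elim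
  | succ t ih =>
    rcases h with h | ⟨-, h⟩
    · exact ⟨t, t.lt_succ_self, h⟩
    · obtain ⟨s, hst, hs⟩ := ih h
      exact ⟨s, hst.trans t.lt_succ_self, hs⟩

lemma PendingWrite.participates (h : PendingWrite M ch σ ω p m t) :
    Participates (M.run ch σ ω t).trace p :=
  let ⟨s, hst, hs, hP, _⟩ := h.exists_invocation
  Algorithm.participates_run_iff.2 ⟨s, hst, hs, hP⟩

lemma Algorithm.OneTime.coin_unique (hM : M.OneTime ch) (h : PendingWrite M ch σ ω p m t)
    (h' : PendingWrite M ch σ ω p m' t') : m = m' := by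
  obtain ⟨s, -, hs, hP, rfl⟩ := h.exists_invocation
  obtain ⟨s', -, hs', hP', rfl⟩ := h'.exists_invocation
  rw [hM.invocation_unique hs hP hs' hP']

lemma run_loc_eq_toWrite_iff {x : ℕ} :
    (∃ next, (M.run ch σ ω t).loc p = .toWrite x next) ↔
      ∃ m, PendingWrite M ch σ ω p m t ∧ ch.x (ω m) = x := by
  induction t with
  | zero => simp [Algorithm.run, Algorithm.init, PendingWrite]
  | succ t ih =>
    by_cases hσ : σ t = p
    · simp [Algorithm.run, hσ, Algorithm.step_loc_eq_toWrite_iff, PendingWrite, and_assoc]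
    · simp [Algorithm.run, M.step_loc_of_ne ch ω _ (Ne.symm hσ), hσ, PendingWrite, ih]

lemma exists_writesAt_of_loc {x : ℕ} {next : Bool → State}
    (h : (M.run ch σ ω t).loc p = .toFlip x next ∨ (M.run ch σ ω t).loc p = .toRead x next) :
    ∃ m, ∃ w < t, WritesAt M ch σ ω p m w ∧ ch.x (ω m) = x := by
  induction t with
  | zero => simp [Algorithm.run, Algorithm.init] at h
  | succ t ih =>
    rw [Algorithm.run] at h
    have earlier (h : (M.run ch σ ω t).loc p = .toFlip x next ∨
        (M.run ch σ ω t).loc p = .toRead x next) :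
        ∃ m, ∃ w < t + 1, WritesAt M ch σ ω p m w ∧ ch.x (ω m) = x :=
      let ⟨m, w, hw, h⟩ := ih h
      ⟨m, w, hw.trans t.lt_succ_self, h⟩
    by_cases hσ : σ t = p
    · rw [hσ] at h
      rcases h with h | h
      · obtain ⟨m, hm, hx⟩ := run_loc_eq_toWrite_iff.1 ⟨next, Algorithm.loc_eq_toWrite_of_step h⟩
        exact ⟨m, t, t.lt_succ_self, ⟨hm, hσ⟩, hx⟩
      · exact earlier (.inl (Algorithm.loc_eq_toFlip_of_step h))
    · rw [M.step_loc_of_ne ch ω _ (Ne.symm hσ)] at h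
      exact earlier h

lemma run_R_ne_zero_iff {j : ℕ} :
    (M.run ch σ ω t).R j ≠ 0 ↔ ∃ w < t, ∃ p m, WritesAt M ch σ ω p m w ∧ ch.x (ω m) = j := by
  induction t with
  | zero => simp [Algorithm.run, Algorithm.init]
  | succ t ih =>
    rw [Algorithm.run, Algorithm.step_R_ne_zero_iff, ih, run_loc_eq_toWrite_iff,
      Nat.exists_lt_succ_right]
    refine or_congr_right ⟨fun ⟨m, hm, hx⟩ => ⟨σ t, m, ⟨hm, rfl⟩, hx⟩, ?_⟩
    rintro ⟨p, m, ⟨hm, rfl⟩, hx⟩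
    exact ⟨m, hm, hx⟩

lemma run_R_ne_zero_mono {j : ℕ} (h : (M.run ch σ ω s).R j ≠ 0) (hst : s ≤ t) :
    (M.run ch σ ω t).R j ≠ 0 :=
  let ⟨w, hw, hR⟩ := run_R_ne_zero_iff.1 h
  run_R_ne_zero_iff.2 ⟨w, hw.trans_le hst, hR⟩

lemma exists_read_of_returns {b : Bool} (h : Returns (M.run ch σ ω t).trace p b) :
    ∃ m w r, w < r ∧ r < t ∧ WritesAt M ch σ ω p m w ∧
      b = decide ((M.run ch σ ω r).R (ch.x (ω m) + 1) = 0) := by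
  induction t with
  | zero => simp [Algorithm.run, Algorithm.init, Returns] at h
  | succ t ih =>
    rcases Algorithm.returns_step h with h | ⟨rfl, x, next, hloc, hb⟩
    · obtain ⟨m, w, r, hwr, hrt, h⟩ := ih h
      exact ⟨m, w, r, hwr, hrt.trans t.lt_succ_self, h⟩
    · obtain ⟨m, w, hwt, hw, rfl⟩ := exists_writesAt_of_loc (.inr hloc)
      exact ⟨m, w, t, hwt, t.lt_succ_self, hw, hb⟩

lemma Algorithm.OneTime.groupElectionProperty (hM : M.OneTime ch)
    {C : Config n Ω Reg State} (hC : M.Reachable ch C) : GroupElectionProperty C.trace := by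
  obtain ⟨σ, ω, t, rfl⟩ := hC
  rintro ⟨p₀, hp₀⟩ hreturn
  have hbound : {j | (M.run ch σ ω t).R j ≠ 0} ⊆ Set.Iic (ell n) := by
    intro j hj
    obtain ⟨w, -, p, m, -, rfl⟩ := run_R_ne_zero_iff.1 hj
    exact ch.le_ell _
  have hwritten : {j | (M.run ch σ ω t).R j ≠ 0}.Nonempty := by
    obtain ⟨b, hb⟩ := hreturn p₀ hp₀
    obtain ⟨m, w, r, hwr, hrt, hw, -⟩ := exists_read_of_returns hb
    exact ⟨_, run_R_ne_zero_iff.2 ⟨w, hwr.trans hrt, p₀, m, hw, rfl⟩⟩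
  obtain ⟨j, hj⟩ := ((Set.finite_Iic _).subset hbound).exists_maximal hwritten
  have hmax : (M.run ch σ ω t).R (j + 1) = 0 := by
    by_contra h
    exact hj.not_prop_of_gt j.lt_succ_self h
  obtain ⟨w, hwt, p, m, hw, rfl⟩ := run_R_ne_zero_iff.1 hj.prop
  obtain ⟨b, hb⟩ := hreturn p (hw.pending.participates.mono (M.run_trace_prefix hwt.le))
  obtain ⟨m', w', r, -, hrt, hw', rfl⟩ := exists_read_of_returns hb
  obtain rfl := hM.coin_unique hw.pending hw'.pending
  have hread : (M.run ch σ ω r).R (ch.x (ω m) + 1) = 0 := by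
    by_contra h
    exact run_R_ne_zero_mono h hrt.le hmax
  exact ⟨p, by simpa [hread] using hb⟩

end Runs

section LocationOblivious

variable {n : ℕ} {Ω Reg State : Type*} [DecidableEq Reg] {D : PMF Ω}
variable {M : Algorithm n Ω Reg State} {ch : IndexChoice n D} {A : Adversary n Ω Reg}

variable (M) in
/-- The configurations `C` and `C'` look the same to a location-oblivious adversary and to every
process other than `p`. -/
structure Indistinguishable (p : Fin n) (C C' : Config n Ω Reg State) : Prop where
  pending : M.pending C p = M.pending C' p
  loc : ∀ q ≠ p, C.loc q = C'.loc q
  mem : C.mem = C'.mem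
  R : C.R = C'.R
  flips : C.flips = C'.flips
  schedule : C.trace.map Step.pid = C'.trace.map Step.pid
  steps : ∀ q ≠ p, C.trace.filter (fun s => s.pid = q) = C'.trace.filter fun s => s.pid = q
  revealed : revealedCoins C.trace p = revealedCoins C'.trace p

namespace Indistinguishable

variable {p : Fin n} {C C' : Config n Ω Reg State} {ω ω' : ℕ → Ω}

lemma adversary_eq (h : Indistinguishable M p C C') (hA : LocationOblivious M ch A)
    (hC : M.Reachable ch C) (hC' : M.Reachable ch C') : A C.trace = A C'.trace := by
  refine hA C C' hC hC' h.schedule (fun q => ?_) fun q => ?_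
  · by_cases hq : q = p
    · exact hq ▸ h.revealed
    · simp only [revealedCoins, h.steps q hq]
  · by_cases hq : q = p
    · exact hq ▸ h.pending
    · simp only [Algorithm.pending, h.loc q hq]

lemma step (h : Indistinguishable M p C C') {q : Fin n} (hq : q ≠ p)
    (hcoin : ω C.flips = ω' C'.flips) :
    Indistinguishable M p (M.step ch ω C q) (M.step ch ω' C' q) := by
  obtain ⟨st, l, mem, R, d, hst, -, hC, hC'⟩ :=
    M.exists_step_eq ch (h.loc q hq) h.mem h.R hcoin
  have hstp : st.pid ≠ p := hst ▸ hq
  rw [hC, hC']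
  constructor
  · simpa [Algorithm.pending, Function.update_of_ne hq.symm] using h.pending
  · intro q' hq'
    by_cases hqq : q' = q
    · simp [hqq]
    · simpa [Function.update_of_ne hqq] using h.loc q' hq'
  · rfl
  · rfl
  · simp [h.flips]
  · simp [h.schedule]
  · intro q' hq'
    simp [List.filter_append, h.steps q' hq']
  · simpa [revealedCoins, List.filter_append, hstp] using h.revealed

lemma of_poised (h : M.Poised C p) :
    Indistinguishable M p (M.step ch ω C p) (M.step ch ω' C p) := by
  obtain ⟨next, hC⟩ := h.step_eq (ch := ch) (ω := ω)
  obtain ⟨next', hC'⟩ := h.step_eq (ch := ch) (ω := ω')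
  rw [hC, hC']
  constructor
  · simp [Algorithm.pending]
  · intro q hq
    simp [Function.update_of_ne hq]
  · rfl
  · rfl
  · rfl
  · simp
  · intro q hq
    simp [List.filter_append, Ne.symm hq]
  · simp [revealedCoins, List.filter_append, Op.isShared]

end Indistinguishable

section Exec

variable {ω ω' : ℕ → Ω} {s t : ℕ}

variable (M ch A) in
/-- The schedule that `A` produces with the coin flip vector `ω`. -/
def Algorithm.schedule (ω : ℕ → Ω) (t : ℕ) : Fin n := A (M.exec ch A ω t).trace

lemma Algorithm.exec_succ :
    M.exec ch A ω (t + 1) = M.step ch ω (M.exec ch A ω t) (M.schedule ch A ω t) := rfl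

lemma Algorithm.run_schedule :
    M.run ch (M.schedule ch A ω) ω t = M.exec ch A ω t := by
  induction t with
  | zero => rfl
  | succ t ih => rw [Algorithm.run, ih, M.exec_succ]

lemma Algorithm.reachable_exec : M.Reachable ch (M.exec ch A ω t) :=
  M.run_schedule ▸ M.reachable_run

lemma Algorithm.exec_trace_prefix (hst : s ≤ t) :
    (M.exec ch A ω s).trace <+: (M.exec ch A ω t).trace := by
  rw [← M.run_schedule, ← M.run_schedule]
  exact M.run_trace_prefix hst

lemma Algorithm.monotone_exec_flips : Monotone fun t => (M.exec ch A ω t).flips :=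
  monotone_nat_of_le_succ fun _ => M.flips_le_step_flips ..

lemma Algorithm.exec_flips_le : (M.exec ch A ω t).flips ≤ t := by
  induction t with
  | zero => rfl
  | succ t ih => exact (M.step_flips_le ..).trans (Nat.add_le_add_right ih 1)

lemma Algorithm.exec_congr (h : ∀ i < (M.exec ch A ω t).flips, ω i = ω' i) :
    M.exec ch A ω' t = M.exec ch A ω t := by
  induction t with
  | zero => rfl
  | succ t ih =>
    rw [Algorithm.exec, ih fun i hi => h i (hi.trans_le (M.monotone_exec_flips t.le_succ))]
    exact Algorithm.step_congr h

lemma PendingWrite.coin_lt_flips {p : Fin n} {m : ℕ}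
    (h : PendingWrite M ch (M.schedule ch A ω) ω p m t) : m < (M.exec ch A ω t).flips := by
  obtain ⟨s, hst, hs, hP, rfl⟩ := h.exists_invocation
  rw [M.run_schedule] at hP ⊢
  obtain ⟨next, h⟩ := hP.step_eq (ch := ch) (ω := ω)
  calc (M.exec ch A ω s).flips < (M.exec ch A ω (s + 1)).flips := by
        rw [M.exec_succ, hs, h]
        exact Nat.lt_succ_self _
    _ ≤ (M.exec ch A ω t).flips := M.monotone_exec_flips hst

-- The adversary and the other processes learn the chosen index only from the write.
lemma PendingWrite.update_coin (hA : LocationOblivious M ch A) {p : Fin n} {m : ℕ}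
    (h : PendingWrite M ch (M.schedule ch A ω) ω p m t) (c : Ω) :
    Indistinguishable M p (M.exec ch A ω t) (M.exec ch A (Function.update ω m c) t) ∧
      PendingWrite M ch (M.schedule ch A (Function.update ω m c)) (Function.update ω m c)
        p m t := by
  induction t with
  | zero => exact h.elim
  | succ t ih =>
    rcases h with ⟨hs, hP, rfl⟩ | ⟨hs, h⟩
    · rw [M.run_schedule] at hP ⊢
      set m := (M.exec ch A ω t).flips
      have hexec : M.exec ch A (Function.update ω m c) t = M.exec ch A ω t :=
        Algorithm.exec_congr fun i hi => (Function.update_of_ne hi.ne c ω).symm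
      have hs' : M.schedule ch A (Function.update ω m c) t = p := by
        rw [Algorithm.schedule, hexec]
        exact hs
      refine ⟨?_, .inl ⟨hs', ?_, ?_⟩⟩
      · rw [M.exec_succ, M.exec_succ, hs, hs', hexec]
        exact .of_poised hP
      · rwa [M.run_schedule, hexec]
      · rw [M.run_schedule, hexec]
    · obtain ⟨hind, hpend⟩ := ih h
      have hsched : M.schedule ch A ω t = M.schedule ch A (Function.update ω m c) t :=
        hind.adversary_eq hA M.reachable_exec M.reachable_exec
      refine ⟨?_, .inr ⟨hsched ▸ hs, hpend⟩⟩
      rw [M.exec_succ, M.exec_succ, ← hsched]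
      refine hind.step hs ?_
      rw [← hind.flips, Function.update_of_ne h.coin_lt_flips.ne']

lemma extends_update {E : Execution n Ω Reg} (hE : ∀ p, ¬ Participates E p)
    (hω : ω ∈ extends_ M ch A E) {p : Fin n} {m : ℕ}
    (h : PendingWrite M ch (M.schedule ch A ω) ω p m t) (c : Ω) :
    Function.update ω m c ∈ extends_ M ch A E := by
  obtain ⟨r, rfl⟩ := hω
  obtain ⟨s, -, hs, hP, rfl⟩ := h.exists_invocation
  rw [M.run_schedule]
  have hrs : r ≤ s := by
    by_contra! hsr
    refine hE p ?_
    rw [← M.run_schedule]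
    exact Algorithm.participates_run_iff.2 ⟨s, hsr, hs, hP⟩
  exact ⟨r, congrArg _ <| Algorithm.exec_congr fun i hi =>
    (Function.update_of_ne (hi.trans_le (M.monotone_exec_flips hrs)).ne c ω).symm⟩

lemma not_participates_of_mem_startExecs [MeasurableSpace Ω] {k : ℕ} {E : Execution n Ω Reg}
    (hE : E ∈ startExecs M ch A k) (p : Fin n) : ¬ Participates E p := by
  obtain ⟨-, ⟨ω, t, rfl, -, hpoised⟩, -⟩ := hE
  rw [← M.run_schedule, Algorithm.participates_run_iff]
  rintro ⟨s, hst, -, hP⟩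
  exact hpoised s hst p (M.run_schedule ▸ hP)

variable (M ch A) in
/-- The event that the execution extends `E`, and that process `a.1` writes in its `elect()`
call, the index of which was chosen by the coin flip number `a.2`, at a time when `R[i + 1]` is
still `0`. The index written to need not be `i`. -/
def vacantWrite (E : Execution n Ω Reg) (i : ℕ) (a : Fin n × ℕ) : Set (ℕ → Ω) :=
  {ω ∈ extends_ M ch A E |
    ∃ w, WritesAt M ch (M.schedule ch A ω) ω a.1 a.2 w ∧ (M.exec ch A ω w).R (i + 1) = 0}

lemma vacantWrite_update (hA : LocationOblivious M ch A) {E : Execution n Ω Reg}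
    (hE : ∀ p, ¬ Participates E p) {i : ℕ} {a : Fin n × ℕ} (hω : ω ∈ vacantWrite M ch A E i a)
    (c : Ω) : Function.update ω a.2 c ∈ vacantWrite M ch A E i a := by
  obtain ⟨hext, w, hw, hR⟩ := hω
  obtain ⟨hind, hpend⟩ := hw.pending.update_coin hA c
  refine ⟨extends_update hE hext hw.pending c, w, ⟨hpend, ?_⟩, hind.R ▸ hR⟩
  rw [← hw.scheduled]
  exact (hind.adversary_eq hA M.reachable_exec M.reachable_exec).symm

end Exec

end LocationOblivious

section Probability

lemma infinitePi_inter_eval_preimage {ι : Type*} [DecidableEq ι] {X : ι → Type*}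
    [∀ i, MeasurableSpace (X i)] (μ : ∀ i, Measure (X i)) [∀ i, IsProbabilityMeasure (μ i)] {i : ι}
    {G : Set (∀ i, X i)} (hG : MeasurableSet G)
    (hupdate : ∀ ω ∈ G, ∀ c, Function.update ω i c ∈ G) {S : Set (X i)} (hS : MeasurableSet S) :
    Measure.infinitePi μ (G ∩ Function.eval i ⁻¹' S) = Measure.infinitePi μ G * μ i S := by
  obtain ⟨c₀⟩ := (μ i).nonempty_of_neZero
  have hGc₀ : (fun ω => Function.update ω i c₀) ⁻¹' G = G := by
    refine Set.Subset.antisymm (fun ω hω => ?_) fun ω hω => hupdate ω hω c₀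
    simpa using hupdate _ hω (ω i)
  let coord (k : ι) : MeasurableSpace (∀ i, X i) := .comap (Function.eval k) inferInstance
  have hupd : Measurable[⨆ k ∈ ({i}ᶜ : Set ι), coord k]
      fun ω : ∀ i, X i => Function.update ω i c₀ := by
    refine @measurable_pi_lambda _ _ _ (_) _ _ fun k => ?_
    obtain rfl | hk := eq_or_ne k i
    · simp only [Function.update_self]
      exact @measurable_const _ _ _ (_) _
    · simp only [Function.update_of_ne hk]
      exact measurable_iff_comap_le.2 (le_iSup₂_of_le k hk le_rfl)
  have hind : Indep (⨆ k ∈ ({i}ᶜ : Set ι), coord k) (⨆ k ∈ ({i} : Set ι), coord k)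
      (Measure.infinitePi μ) :=
    indep_iSup_of_disjoint (fun k => (measurable_pi_apply k).comap_le)
      (iIndepFun_infinitePi (P := μ) (X := fun _ c => c) fun _ => measurable_id).iIndep
      disjoint_compl_left
  have hS' : MeasurableSet[⨆ k ∈ ({i} : Set ι), coord k] (Function.eval i ⁻¹' S) :=
    le_iSup₂ (f := fun k (_ : k ∈ ({i} : Set ι)) => coord k) i rfl _ ⟨S, hS, rfl⟩
  rw [(Indep_iff _ _ _).1 hind G _ (hGc₀ ▸ hupd hG) hS',
    (measurePreserving_eval_infinitePi μ i).measure_preimage hS.nullMeasurableSet]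

variable {Ω : Type*} [MeasurableSpace Ω]

instance isProbabilityMeasure_coinMeasure (D : PMF Ω) : IsProbabilityMeasure (coinMeasure D) :=
  inferInstanceAs (IsProbabilityMeasure (Measure.infinitePi fun _ => D.toMeasure))

lemma coinMeasure_inter_eq [DiscreteMeasurableSpace Ω] (D : PMF Ω) {G : Set (ℕ → Ω)}
    (hG : MeasurableSet G) {m : ℕ} (hupdate : ∀ ω ∈ G, ∀ c, Function.update ω m c ∈ G)
    (x : Ω → ℕ) (i : ℕ) :
    coinMeasure D (G ∩ {ω | x (ω m) = i}) = coinMeasure D G * D.map x i := by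
  rw [← PMF.toMeasure_apply_singleton (D.map x) i (measurableSet_singleton i),
    PMF.toMeasure_map_apply _ _ _ (Measurable.of_discrete) (measurableSet_singleton i)]
  exact infinitePi_inter_eval_preimage (fun _ => D.toMeasure) hG hupdate
    (S := x ⁻¹' {i}) .of_discrete

lemma lintegral_encard_eq_tsum {X ι : Type*} [MeasurableSpace X] [Countable ι] (μ : Measure X)
    {B : ι → Set X} (hB : ∀ j, MeasurableSet (B j)) :
    ∫⁻ ω, ({j | ω ∈ B j}.encard : ℝ≥0∞) ∂μ = ∑' j, μ (B j) := by
  have hencard (ω : X) :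
      ({j | ω ∈ B j}.encard : ℝ≥0∞) = ∑' j, (B j).indicator (fun _ => (1 : ℝ≥0∞)) ω := by
    rw [← ENNReal.tsum_set_one, tsum_subtype {j | ω ∈ B j} fun _ => (1 : ℝ≥0∞)]
    rfl
  simp_rw [hencard]
  rw [lintegral_tsum fun j => (measurable_const.indicator (hB j)).aemeasurable]
  simp [lintegral_indicator, hB]

lemma tsum_measure_le_of_encard_le {X ι : Type*} [MeasurableSpace X] [Countable ι] (μ : Measure X)
    [IsProbabilityMeasure μ] {B : ι → Set X} (hB : ∀ j, MeasurableSet (B j)) {k : ℕ∞}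
    (hk : ∀ ω, {j | ω ∈ B j}.encard ≤ k) : ∑' j, μ (B j) ≤ k :=
  calc ∑' j, μ (B j) = ∫⁻ ω, ({j | ω ∈ B j}.encard : ℝ≥0∞) ∂μ :=
        (lintegral_encard_eq_tsum μ hB).symm
    _ ≤ ∫⁻ _, k ∂μ := lintegral_mono fun ω => ENat.toENNReal_mono (hk ω)
    _ = k := by simp

lemma sum_min_two_mul_inv_two_pow_le (k N : ℕ) :
    ∑ i ∈ Finset.Ico 1 N, min 2 (k * (2⁻¹ : ℝ≥0∞) ^ i) ≤ 2 * Nat.log 2 k + 2 := by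
  have htail (d : ℕ) : k * (2⁻¹ : ℝ≥0∞) ^ (Nat.log 2 k + 1 + d) ≤ 2⁻¹ ^ d := by
    have hk : (k : ℝ≥0∞) ≤ 2 ^ (Nat.log 2 k + 1) := by
      exact_mod_cast (Nat.lt_pow_succ_log_self one_lt_two k).le
    calc k * (2⁻¹ : ℝ≥0∞) ^ (Nat.log 2 k + 1 + d)
        ≤ 2 ^ (Nat.log 2 k + 1) * 2⁻¹ ^ (Nat.log 2 k + 1 + d) := by gcongr
      _ = (2 * 2⁻¹) ^ (Nat.log 2 k + 1) * 2⁻¹ ^ d := by ring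
      _ = 2⁻¹ ^ d := by rw [ENNReal.mul_inv_cancel (by simp) (by simp), one_pow, one_mul]
  calc ∑ i ∈ Finset.Ico 1 N, min 2 (k * (2⁻¹ : ℝ≥0∞) ^ i)
      ≤ ∑ i ∈ Finset.Ico 1 (Nat.log 2 k + 1 + N), min 2 (k * (2⁻¹ : ℝ≥0∞) ^ i) := by
        gcongr
        lia
    _ = ∑ i ∈ Finset.Ico 1 (Nat.log 2 k + 1), min 2 (k * (2⁻¹ : ℝ≥0∞) ^ i)
        + ∑ d ∈ Finset.range N, min 2 (k * (2⁻¹ : ℝ≥0∞) ^ (Nat.log 2 k + 1 + d)) := by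
        rw [← Finset.sum_Ico_consecutive _ (Nat.le_add_left 1 _) (Nat.le_add_right _ N),
          Finset.sum_Ico_eq_sum_range _ (Nat.log 2 k + 1), Nat.add_sub_cancel_left]
    _ ≤ ∑ i ∈ Finset.Ico 1 (Nat.log 2 k + 1), 2 + ∑' d, 2⁻¹ ^ d := by
        gcongr
        · exact min_le_left _ _
        · exact (Finset.sum_le_sum fun d _ => (min_le_right _ _).trans (htail d)).trans
            (ENNReal.sum_le_tsum _)
    _ = 2 * Nat.log 2 k + 2 := by
        simp [ENNReal.tsum_geometric, mul_comm]

end Probability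

section Effectiveness

variable {n : ℕ} {Ω Reg State : Type*} [DecidableEq Reg] {D : PMF Ω}
variable {M : Algorithm n Ω Reg State} {ch : IndexChoice n D} {A : Adversary n Ω Reg}

section Measurability

variable [Countable Ω] [MeasurableSpace Ω] [DiscreteMeasurableSpace Ω]

lemma measurableSet_exec (P : Config n Ω Reg State → Prop) (t : ℕ) :
    MeasurableSet {ω | P (M.exec ch A ω t)} := by
  have hdep : DependsOn (fun ω => P (M.exec ch A ω t)) (Set.Iio t) := fun ω ω' h =>
    congrArg P (Algorithm.exec_congr fun i hi => h i (hi.trans_le M.exec_flips_le)).symm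
  obtain ⟨Q, hQ⟩ := (Function.factorsThrough_iff _).1 (dependsOn_iff_factorsThrough.1 hdep)
  have hset : {ω | P (M.exec ch A ω t)} = (Set.Iio t).domRestrict ⁻¹' {f | Q f} :=
    Set.ext fun ω => (congrFun hQ ω).to_iff
  rw [hset]
  have hrestrict : Measurable (Set.domRestrict (π := fun _ => Ω) (Set.Iio t)) := by fun_prop
  exact hrestrict (Set.to_countable _).measurableSet

lemma measurableSet_pendingWrite (p : Fin n) (m t : ℕ) :
    MeasurableSet {ω | PendingWrite M ch (M.schedule ch A ω) ω p m t} := by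
  induction t with
  | zero => exact MeasurableSet.empty
  | succ t ih =>
    simp only [PendingWrite, M.run_schedule]
    exact (measurableSet_exec (fun C => A C.trace = p ∧ M.Poised C p ∧ C.flips = m) t).union
      ((measurableSet_exec (fun C => A C.trace ≠ p) t).inter ih)

lemma measurableSet_extends (E : Execution n Ω Reg) : MeasurableSet (extends_ M ch A E) := by
  rw [extends_, Set.ofPred_exists]
  exact .iUnion fun t => measurableSet_exec (fun C => C.trace = E) t

lemma measurableSet_vacantWrite (E : Execution n Ω Reg) (i : ℕ) (a : Fin n × ℕ) :
    MeasurableSet (vacantWrite M ch A E i a) := by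
  have hset : vacantWrite M ch A E i a = extends_ M ch A E ∩
      ⋃ w, {ω | PendingWrite M ch (M.schedule ch A ω) ω a.1 a.2 w} ∩
        {ω | A (M.exec ch A ω w).trace = a.1 ∧ (M.exec ch A ω w).R (i + 1) = 0} := by
    ext ω
    simp only [Set.mem_inter_iff, Set.mem_iUnion]
    exact and_congr_right fun _ => exists_congr fun w =>
      ⟨fun ⟨⟨h, hs⟩, hR⟩ => ⟨h, hs, hR⟩, fun ⟨h, hs, hR⟩ => ⟨⟨h, hs⟩, hR⟩⟩
  rw [hset]
  exact (measurableSet_extends E).inter <| .iUnion fun w =>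
    (measurableSet_pendingWrite _ _ _).inter
      (measurableSet_exec (fun C => A C.trace = a.1 ∧ C.R (i + 1) = 0) w)

end Measurability

section Counting

variable {E : Execution n Ω Reg}

lemma ncard_participates_le_maxContention {C : Config n Ω Reg State} (hC : M.Reachable ch C)
    (hE : E <+: C.trace) : {p | Participates C.trace p}.ncard ≤ maxContention M ch E := by
  refine le_csSup ⟨n, ?_⟩ ⟨C, hC, hE, rfl⟩
  rintro _ ⟨C', -, -, rfl⟩
  exact (Set.ncard_le_ncard (Set.subset_univ _)).trans_eq (by simp)

lemma injOn_fst_vacantWrite (hM : M.OneTime ch) (i : ℕ) (ω : ℕ → Ω) :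
    Set.InjOn Prod.fst {a | ω ∈ vacantWrite M ch A E i a} := by
  rintro ⟨p, m⟩ ⟨-, w, hw, -⟩ ⟨_, m'⟩ ⟨-, w', hw', -⟩ rfl
  exact congrArg _ (hM.coin_unique hw.pending hw'.pending)

lemma encard_vacantWrite_le (hM : M.OneTime ch) (i : ℕ) (ω : ℕ → Ω) :
    {a | ω ∈ vacantWrite M ch A E i a}.encard ≤ maxContention M ch E := by
  obtain hempty | ⟨_, ⟨t, rfl⟩, -⟩ := {a | ω ∈ vacantWrite M ch A E i a}.eq_empty_or_nonempty
  · simp [hempty]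
  have hlate : ∀ᶠ N in Filter.atTop, ∀ p, (∃ s, Participates (M.exec ch A ω s).trace p) →
      Participates (M.exec ch A ω N).trace p := by
    refine Filter.eventually_all.2 fun p => ?_
    by_cases h : ∃ s, Participates (M.exec ch A ω s).trace p
    · obtain ⟨s, hs⟩ := h
      filter_upwards [Filter.eventually_ge_atTop s] with N hN _
      exact hs.mono (M.exec_trace_prefix hN)
    · exact .of_forall fun _ h' => absurd h' h
  obtain ⟨N, hN, htN⟩ := (hlate.and (Filter.eventually_ge_atTop t)).exists
  calc {a | ω ∈ vacantWrite M ch A (M.exec ch A ω t).trace i a}.encard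
      ≤ {p | Participates (M.exec ch A ω N).trace p}.encard :=
        Set.encard_le_encard_of_injOn
          (fun _ ⟨_, w, hw, _⟩ => hN _ ⟨w, M.run_schedule ▸ hw.pending.participates⟩)
          (injOn_fst_vacantWrite hM i ω)
    _ = ({p | Participates (M.exec ch A ω N).trace p}.ncard : ℕ∞) :=
        (Set.toFinite _).cast_ncard_eq.symm
    _ ≤ maxContention M ch (M.exec ch A ω t).trace := by
        exact_mod_cast
          ncard_participates_le_maxContention M.reachable_exec (M.exec_trace_prefix htN)

-- The first write to `R[i + 1]` makes the register nonzero for all later ones.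
lemma encard_vacantWrite_own_le_one (hM : M.OneTime ch) (i : ℕ) (ω : ℕ → Ω) :
    {a | ω ∈ vacantWrite M ch A E i a ∩ {ω | ch.x (ω a.2) = i + 1}}.encard ≤ 1 := by
  rw [Set.encard_le_one_iff]
  rintro a b ⟨ha, hxa⟩ ⟨hb, hxb⟩
  have first {a : Fin n × ℕ} {w w' : ℕ} (hw : WritesAt M ch (M.schedule ch A ω) ω a.1 a.2 w)
      (hx : ch.x (ω a.2) = i + 1) (hR : (M.exec ch A ω w').R (i + 1) = 0) : w' ≤ w := by
    by_contra! hlt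
    exact run_R_ne_zero_iff.2 ⟨w, hlt, a.1, a.2, hw, hx⟩ (M.run_schedule ▸ hR)
  obtain ⟨-, w, hw, hR⟩ := id ha
  obtain ⟨-, w', hw', hR'⟩ := id hb
  obtain rfl : w = w' := (first hw' hxb hR).antisymm (first hw hxa hR')
  exact injOn_fst_vacantWrite hM i ω ha hb (hw.scheduled.symm.trans hw'.scheduled)

lemma wins_le_encard {ω : ℕ → Ω} (hω : ω ∈ extends_ M ch A E) :
    (wins M ch A ω : ℕ∞) ≤ {a | ω ∈ ⋃ i ∈ Finset.Icc 1 (ell n),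
      vacantWrite M ch A E i a ∩ {ω | ch.x (ω a.2) = i}}.encard := by
  rw [wins, (Set.toFinite _).cast_ncard_eq]
  refine le_trans (Set.encard_le_encard ?_) (Set.encard_image_le Prod.fst _)
  rintro p ⟨t, ht⟩
  obtain ⟨m, w, r, hwr, -, hw, hwin⟩ := exists_read_of_returns (M.run_schedule ▸ ht)
  have hR : (M.exec ch A ω w).R (ch.x (ω m) + 1) = 0 := by
    by_contra h
    rw [← M.run_schedule] at h
    exact run_R_ne_zero_mono h hwr.le (of_decide_eq_true hwin.symm)
  refine ⟨(p, m), Set.mem_biUnion (x := ch.x (ω m)) ?_ ⟨⟨hω, w, hw, hR⟩, rfl⟩, rfl⟩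
  simp [ch.one_le, ch.le_ell]

end Counting

lemma inv_two_pow_le_prob (ch : IndexChoice n D) {i : ℕ} (h1 : 1 ≤ i) (hi : i ≤ ell n) :
    (2⁻¹ : ℝ≥0∞) ^ i ≤ D.map ch.x i := by
  rcases hi.lt_or_eq with h | rfl
  · rw [ch.prob_of_lt i h1 h]
  · rw [ch.prob_ell]
    exact pow_le_pow_right_of_le_one' (by simp) (Nat.sub_le _ _)

section ConditionalExpectation

variable [MeasurableSpace Ω] {E : Execution n Ω Reg} {i k : ℕ}

variable (M ch A E i) in
/-- The conditional expectation, given that the execution extends `E`, of the number of processes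
that write in their `elect()` call while `R[i + 1]` is still `0`. -/
noncomputable def expectedVacantWrites : ℝ≥0∞ :=
  ∑' a, cond (coinMeasure D) (extends_ M ch A E) (vacantWrite M ch A E i a)

lemma isProbabilityMeasure_cond_extends (hE : E ∈ startExecs M ch A k) :
    IsProbabilityMeasure (cond (coinMeasure D) (extends_ M ch A E)) :=
  cond_isProbabilityMeasure hE.1

variable [Countable Ω] [DiscreteMeasurableSpace Ω]

lemma measurableSet_vacantWrite_inter (E : Execution n Ω Reg) (i j : ℕ) (a : Fin n × ℕ) :
    MeasurableSet (vacantWrite M ch A E i a ∩ {ω | ch.x (ω a.2) = j}) :=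
  (measurableSet_vacantWrite E i a).inter
    (measurable_pi_apply (X := fun _ => Ω) a.2 (t := {c | ch.x c = j}) .of_discrete)

-- Location-obliviousness makes `vacantWrite` insensitive to the index that is chosen.
lemma cond_vacantWrite_inter (hA : LocationOblivious M ch A) (hE : ∀ p, ¬ Participates E p)
    (j : ℕ) (a : Fin n × ℕ) :
    cond (coinMeasure D) (extends_ M ch A E)
        (vacantWrite M ch A E i a ∩ {ω | ch.x (ω a.2) = j}) =
      cond (coinMeasure D) (extends_ M ch A E) (vacantWrite M ch A E i a) * D.map ch.x j := by
  have hsub : extends_ M ch A E ∩ vacantWrite M ch A E i a = vacantWrite M ch A E i a :=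
    Set.inter_eq_right.2 fun _ h => h.1
  rw [cond_apply (measurableSet_extends E), cond_apply (measurableSet_extends E),
    ← Set.inter_assoc, hsub, coinMeasure_inter_eq D (measurableSet_vacantWrite E i a)
      (fun _ hω => vacantWrite_update hA hE hω), mul_assoc]

lemma expectedVacantWrites_le (hM : M.OneTime ch) (hE : E ∈ startExecs M ch A k) :
    expectedVacantWrites M ch A E i ≤ k := by
  have := isProbabilityMeasure_cond_extends hE
  refine tsum_measure_le_of_encard_le (k := k) _ (measurableSet_vacantWrite E i) fun ω => ?_
  exact (encard_vacantWrite_le hM i ω).trans (by exact_mod_cast hE.2.2)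

lemma expectedVacantWrites_mul_le_one (hM : M.OneTime ch) (hA : LocationOblivious M ch A)
    (hE : E ∈ startExecs M ch A k) :
    expectedVacantWrites M ch A E i * D.map ch.x (i + 1) ≤ 1 := by
  have := isProbabilityMeasure_cond_extends hE
  rw [expectedVacantWrites, ← ENNReal.tsum_mul_right]
  simp_rw [← cond_vacantWrite_inter hA (not_participates_of_mem_startExecs hE)]
  exact (tsum_measure_le_of_encard_le _ (measurableSet_vacantWrite_inter E i (i + 1))
    (encard_vacantWrite_own_le_one hM i)).trans_eq ENat.toENNReal_one

lemma lintegral_wins_le_sum (hA : LocationOblivious M ch A) (hE : ∀ p, ¬ Participates E p) :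
    ∫⁻ ω, (wins M ch A ω : ℝ≥0∞) ∂(cond (coinMeasure D) (extends_ M ch A E)) ≤
      ∑ i ∈ Finset.Icc 1 (ell n), expectedVacantWrites M ch A E i * D.map ch.x i := by
  set P := cond (coinMeasure D) (extends_ M ch A E)
  let W (i : ℕ) (a : Fin n × ℕ) := vacantWrite M ch A E i a ∩ {ω | ch.x (ω a.2) = i}
  calc ∫⁻ ω, (wins M ch A ω : ℝ≥0∞) ∂P
      ≤ ∫⁻ ω, ({a | ω ∈ ⋃ i ∈ Finset.Icc 1 (ell n), W i a}.encard : ℝ≥0∞) ∂P := by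
        refine lintegral_mono_ae ?_
        filter_upwards [ae_cond_mem (measurableSet_extends E)] with ω hω
        exact_mod_cast ENat.toENNReal_mono (wins_le_encard hω)
    _ = ∑' a, P (⋃ i ∈ Finset.Icc 1 (ell n), W i a) :=
        lintegral_encard_eq_tsum P fun a =>
          Finset.measurableSet_biUnion _ fun i _ => measurableSet_vacantWrite_inter E i i a
    _ ≤ ∑' a, ∑ i ∈ Finset.Icc 1 (ell n), P (W i a) :=
        ENNReal.tsum_le_tsum fun a => measure_biUnion_finset_le _ _
    _ = ∑ i ∈ Finset.Icc 1 (ell n), ∑' a, P (W i a) :=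
        Summable.tsum_finsetSum fun _ _ => ENNReal.summable
    _ = ∑ i ∈ Finset.Icc 1 (ell n), expectedVacantWrites M ch A E i * D.map ch.x i :=
        Finset.sum_congr rfl fun i _ => by
          simp_rw [W, P, cond_vacantWrite_inter hA hE, ENNReal.tsum_mul_right,
            expectedVacantWrites]

lemma expectedVacantWrites_mul_le_min (hM : M.OneTime ch) (hA : LocationOblivious M ch A)
    (hE : E ∈ startExecs M ch A k) (h1 : 1 ≤ i) (hi : i < ell n) :
    expectedVacantWrites M ch A E i * D.map ch.x i ≤ min 2 (k * (2⁻¹ : ℝ≥0∞) ^ i) := by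
  rw [ch.prob_of_lt i h1 hi]
  refine le_min ?_ (by gcongr; exact expectedVacantWrites_le hM hE)
  calc expectedVacantWrites M ch A E i * 2⁻¹ ^ i
      = 2 * 2⁻¹ * (expectedVacantWrites M ch A E i * 2⁻¹ ^ i) := by
        rw [ENNReal.mul_inv_cancel (by simp) (by simp), one_mul]
    _ = 2 * (expectedVacantWrites M ch A E i * 2⁻¹ ^ (i + 1)) := by ring
    _ ≤ 2 * (expectedVacantWrites M ch A E i * D.map ch.x (i + 1)) := by
        gcongr
        exact inv_two_pow_le_prob ch (Nat.le_add_left 1 i) hi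
    _ ≤ 2 * 1 := by
        gcongr
        exact expectedVacantWrites_mul_le_one hM hA hE
    _ = 2 := mul_one 2

lemma expectedVacantWrites_ell_mul_le_two (hM : M.OneTime ch) (hE : E ∈ startExecs M ch A k)
    (hkn : k ≤ n) (hell : 1 ≤ ell n) :
    expectedVacantWrites M ch A E (ell n) * D.map ch.x (ell n) ≤ 2 := by
  have hk : (k : ℝ≥0∞) ≤ 2 ^ (1 + (ell n - 1)) := by
    rw [Nat.add_sub_cancel' hell]
    exact_mod_cast hkn.trans (Nat.le_pow_clog one_lt_two n)
  calc expectedVacantWrites M ch A E (ell n) * D.map ch.x (ell n)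
      ≤ 2 ^ (1 + (ell n - 1)) * 2⁻¹ ^ (ell n - 1) := by
        rw [ch.prob_ell]
        gcongr
        exact (expectedVacantWrites_le hM hE).trans hk
    _ = 2 * (2 * 2⁻¹) ^ (ell n - 1) := by ring
    _ = 2 := by rw [ENNReal.mul_inv_cancel (by simp) (by simp), one_pow, mul_one]

lemma lintegral_wins_le (hM : M.OneTime ch) (hA : LocationOblivious M ch A) (hkn : k ≤ n)
    (hE : E ∈ startExecs M ch A k) :
    ∫⁻ ω, (wins M ch A ω : ℝ≥0∞) ∂(cond (coinMeasure D) (extends_ M ch A E)) ≤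
      2 * Nat.log 2 k + 4 := by
  obtain ⟨c, -⟩ := D.support_nonempty
  have hell : 1 ≤ ell n := (ch.one_le c).trans (ch.le_ell c)
  calc ∫⁻ ω, (wins M ch A ω : ℝ≥0∞) ∂(cond (coinMeasure D) (extends_ M ch A E))
      ≤ ∑ i ∈ Finset.Icc 1 (ell n), expectedVacantWrites M ch A E i * D.map ch.x i :=
        lintegral_wins_le_sum hA (not_participates_of_mem_startExecs hE)
    _ = ∑ i ∈ Finset.Ico 1 (ell n), expectedVacantWrites M ch A E i * D.map ch.x i
        + expectedVacantWrites M ch A E (ell n) * D.map ch.x (ell n) := by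
        rw [← Finset.Ico_add_one_right_eq_Icc, Finset.sum_Ico_succ_top hell]
    _ ≤ ∑ i ∈ Finset.Ico 1 (ell n), min 2 (k * (2⁻¹ : ℝ≥0∞) ^ i) + 2 := by
        refine add_le_add (Finset.sum_le_sum fun i hi => ?_)
          (expectedVacantWrites_ell_mul_le_two hM hE hkn hell)
        obtain ⟨h1, hi⟩ := Finset.mem_Ico.1 hi
        exact expectedVacantWrites_mul_le_min hM hA hE h1 hi
    _ ≤ 2 * Nat.log 2 k + 2 + 2 := by
        gcongr
        exact sum_min_two_mul_inv_two_pow_le k (ell n)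
    _ = 2 * Nat.log 2 k + 4 := by ring

theorem effectiveness_le (hM : M.OneTime ch) (hA : LocationOblivious M ch A) (hkn : k ≤ n) :
    effectiveness M ch A k ≤ ENNReal.ofReal (2 * Real.logb 2 k + 4) := by
  have hlog : (Nat.log 2 k : ℝ) ≤ Real.logb 2 k := by exact_mod_cast Real.natLog_le_logb k 2
  calc effectiveness M ch A k
      ≤ 2 * Nat.log 2 k + 4 := iSup₂_le fun E hE => lintegral_wins_le hM hA hkn hE
    _ = ENNReal.ofReal ((2 * Nat.log 2 k + 4 : ℕ) : ℝ) := by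
        rw [ENNReal.ofReal_natCast]
        push_cast
        rfl
    _ ≤ ENNReal.ofReal (2 * Real.logb 2 k + 4) := by
        push_cast
        gcongr

end ConditionalExpectation

end Effectiveness

section MaxSteps

variable {n : ℕ} {Ω Reg State : Type*} [DecidableEq Reg] {D : PMF Ω}
variable {M : Algorithm n Ω Reg State} {ch : IndexChoice n D} {A : Adversary n Ω Reg}

lemma maxSteps_le_two (hM : M.OneTime ch) (ω : ℕ → Ω) : maxSteps M ch A ω ≤ 2 :=
  iSup₂_le fun p _ => by exact_mod_cast M.reachable_exec.electSteps_le_two hM p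

variable [MeasurableSpace Ω]

lemma maxStepsBoundedWithProb_two (hM : M.OneTime ch) (k : ℕ) :
    MaxStepsBoundedWithProb M ch A (fun _ => 2) (fun _ => 1) k := by
  intro E hE
  have := isProbabilityMeasure_cond_extends hE
  simp [maxSteps_le_two hM]

lemma expectedMaxSteps_le_two (hM : M.OneTime ch) (k : ℕ) : expectedMaxSteps M ch A k ≤ 2 := by
  refine iSup₂_le fun E hE => ?_
  have := isProbabilityMeasure_cond_extends hE
  calc ∫⁻ ω, maxSteps M ch A ω ∂(cond (coinMeasure D) (extends_ M ch A E))
      ≤ ∫⁻ _, 2 ∂(cond (coinMeasure D) (extends_ M ch A E)) :=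
        lintegral_mono fun ω => maxSteps_le_two hM ω
    _ = 2 := by simp

end MaxSteps

end GroupElection

theorem lemma3p3 (n : ℕ) (hn : 2 ≤ n) {Ω Reg State : Type*} [Countable Ω] [MeasurableSpace Ω]
    [DiscreteMeasurableSpace Ω] [DecidableEq Reg] (D : PMF Ω) (ch : IndexChoice n D)
    (M : Algorithm n Ω Reg State) (hM : M.OneTime ch) :
    -- it is a group election object, in every execution
    (∀ C, M.Reachable ch C → GroupElectionProperty C.trace) ∧
    -- a call returns after at most three further steps of the calling process
    (∀ (σ : ℕ → Fin n) (ω : ℕ → Ω) (t t' : ℕ) (p : Fin n),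
      Participates (M.run ch σ ω t).trace p →
      3 ≤ ((Finset.Ico t t').filter fun s => σ s = p).card →
      ∃ b, Returns (M.run ch σ ω t').trace p b) ∧
    -- constant max-step complexity, in every execution
    (∀ C, M.Reachable ch C → ∀ p, electSteps C.trace p ≤ 2) ∧
    -- max-step complexity and effectiveness against location-oblivious adversaries
    (∀ A : Adversary n Ω Reg, LocationOblivious M ch A → ∀ k : ℕ, 1 ≤ k → k ≤ n →
      MaxStepsBoundedWithProb M ch A (fun _ => 2) (fun _ => 1) k ∧
      expectedMaxSteps M ch A k ≤ 2 ∧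
      effectiveness M ch A k ≤ ENNReal.ofReal (2 * Real.logb 2 k + 4)) :=
  ⟨fun _ hC => hM.groupElectionProperty hC,
    fun _ _ _ _ _ => Algorithm.exists_returns_of_three_steps,
    fun _ hC => hC.electSteps_le_two hM,
    fun _ hA k _ hkn =>
      ⟨maxStepsBoundedWithProb_two hM k, expectedMaxSteps_le_two hM k, effectiveness_le hM hA hkn⟩⟩
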